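/- **Setting.** A game has $n\ge 1$ senders, finite non-empty sets $\Theta$ (states), $S$ (signals), $\mathcal A$ (actions) and a set $\Phi$ of deviation functions $\varphi:S\to S$. An instance consists of a prior $p\in\Delta(\Theta)$, a signaling scheme $\psi:\Theta\to\Delta(S)$ common to the senders, and payoffs $u_R,u_S:\mathcal A\times\Theta\to[0,1]$ (of the receiver, and of every sender). A mechanism $x$ maps each signal profile $s\in S^n$ to a distribution $x[s,\cdot]$ over $\mathcal A$; it is symmetric if $x[s,\cdot]$ depends only on how often each signal occurs in $s$. For $j\in\{R,S\}$ put $$U_j(x)=\sum_{s,a}x[s,a]\sum_\theta p(\theta)u_j(a,\theta)\prod_{k}\psi(s_k|\theta),\qquad U_i^\varphi(x)=\sum_{s,a}x[(\varphi(s_i),s_{-i}),a]\sum_\theta p(\theta)u_S(a,\theta)\prod_{k}\psi(s_k|\theta).$$ The mechanism $x$ is incentive compatible (IC) if $U_i^\varphi(x)\le U_S(x)$ for all senders $i$ and all $\varphi\in\Phi$; let $x^\star$ maximize $U_R$ over the IC mechanisms. **Bandit feedback.** The receiver knows $n,\Theta,S,\mathcal A,\Phi$ and the horizon $T$, but not the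 instance $(p,\psi,u_R,u_S)$. In each round $t=1,\dots,T$ she selects a symmetric mechanism $\xi^t$, as a function of internal randomness and of the observations of the previous rounds; then $\theta^t\sim p$ is drawn, the signals $s^t_1,\dots,s^t_n\sim\psi(\cdot|\theta^t)$ are drawn independently and are reported truthfully, $a^t\sim\xi^t[s^t,\cdot]$ is drawn, and she observes only $s^t$, $a^t$, $u_S(a^t,\theta^t)$ and $u_R(a^t,\theta^t)$. A (possibly randomized) rule of this kind for every horizon $T$ is called an algorithm. Let $$R^T=\sum_{t=1}^T\bigl(U_R(x^\star)-U_R(\xi^t)\bigr),\qquad V^T=\sum_{t=1}^T\max_{\varphi\in\Phi,\ i}\bigl(U_i^\varphi(\xi^t)-U_S(\xi^t)\bigr).$$ An algorithm achieves $R^T=o(T^\alpha)$ and $V^T=o(T^{1-\alpha/2})$ with probability greater than $1-\delta$ if there are functions $r(T)=o(T^\alpha)$ and $v(T)=o(T^{1-\alpha/2})$ such that, for all sufficiently large $T$ and for every instance, $\mathbb P\bigl(R^T\le r(T)\text{ and }V^T\le v(T)\bigr)>1-\delta$. **Theorem.** For every $\alpha\in[1/2,1]$ there are $\delta\in(0,1)$,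 a number $n\geq 1$ of senders and finite non-empty sets $\Theta,S,\mathcal A$ such that the following holds for every set $\Phi$ of deviation functions that contains all constant maps $S\to S$ (the ex-ante deviations), or that contains all maps $S\to S$ which change at most one signal: no algorithm achieves both $R^T=o(T^\alpha)$ and $V^T=o(T^{1-\alpha/2})$ with probability greater than $1-\delta$ under bandit feedback. -/

import Mathlib

open MeasureTheory Filter Asymptotics

namespace InfoAcq

noncomputable section

/-- An instance of the game with `n` symmetric senders, states `Θ`, signals `S`, actions `A`.
Everything recorded here is unknown to the receiver under bandit feedback. -/
structure Game (Θ S A : Type) [Fintype Θ] [Fintype S] where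
  /-- prior `p` over the states of nature -/
  prior : Θ → ℝ
  prior_mem : prior ∈ stdSimplex ℝ Θ
  /-- signaling scheme shared by the senders: `signal θ s` is the probability of `s` given `θ` -/
  signal : Θ → S → ℝ
  signal_mem : ∀ θ, signal θ ∈ stdSimplex ℝ S
  /-- payoff of the receiver -/
  uR : A → Θ → ℝ
  uR_mem : ∀ a θ, uR a θ ∈ Set.Icc (0 : ℝ) 1
  /-- common payoff of the senders -/
  uS : A → Θ → ℝ
  uS_mem : ∀ a θ, uS a θ ∈ Set.Icc (0 : ℝ) 1

/-- The class of a signal profile: two profiles have the same class iff every signal occurs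
equally often in both. -/
def profileClass {n : ℕ} {S : Type} (s : Fin n → S) : Sym S n :=
  Sym.mk (Finset.univ.val.map s) (by simp)

/-- A mechanism assigns to every signal profile a probability distribution over actions. -/
def IsMechanism {n : ℕ} {S A : Type} [Fintype A] (x : (Fin n → S) → A → ℝ) : Prop :=
  ∀ s, x s ∈ stdSimplex ℝ A

/-- Symmetric mechanisms in compact form: a distribution over actions for every class. -/
abbrev SymMechanism (n : ℕ) (S A : Type) [Fintype A] : Type :=
  Sym S n → stdSimplex ℝ A

/-- The mechanism on profiles that a symmetric mechanism represents. -/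
def SymMechanism.toMechanism {n : ℕ} {S A : Type} [Fintype A] (ξ : SymMechanism n S A) :
    (Fin n → S) → A → ℝ :=
  fun s a => (ξ (profileClass s) : A → ℝ) a

/-- Two profiles get the same class exactly if they are symmetric. -/
theorem profileClass_eq_iff {n : ℕ} {S : Type} [DecidableEq S] (s s' : Fin n → S) :
    profileClass s = profileClass s' ↔
      ∀ y : S, (∑ i, if s i = y then 1 else 0 : ℕ) = ∑ i, if s' i = y then 1 else 0 := by
  have key : ∀ (f : Fin n → S) (y : S),
      (Finset.univ.val.map f).count y = ∑ i, if f i = y then 1 else 0 := by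
    intro f y
    rw [Multiset.count_map, Finset.sum_boole]
    simp [Finset.card, eq_comm]
  simp only [← key]
  rw [← Multiset.ext, profileClass, profileClass]
  exact Subtype.mk_eq_mk

section Static

variable {n : ℕ} {Θ S A : Type} [Fintype Θ] [Fintype S] [Fintype A]

/-- Expected utility, for the payoff function `u`, of the mechanism `x` under truthful reports. -/
def Game.utility (G : Game Θ S A) (u : A → Θ → ℝ) (x : (Fin n → S) → A → ℝ) : ℝ :=
  ∑ s : Fin n → S, ∑ a, x s a * ∑ θ, G.prior θ * u a θ * ∏ j, G.signal θ (s j)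

/-- Expected utility of sender `i` when she reports `φ (s i)` instead of `s i`. -/
def Game.devUtility (G : Game Θ S A) (φ : S → S) (i : Fin n) (x : (Fin n → S) → A → ℝ) : ℝ :=
  ∑ s : Fin n → S, ∑ a, x (Function.update s i (φ (s i))) a *
    ∑ θ, G.prior θ * G.uS a θ * ∏ j, G.signal θ (s j)

/-- The set of `ε`-IC mechanisms for the deviation functions `Φ`. -/
def Game.icSet (G : Game Θ S A) (n : ℕ) (Φ : Set (S → S)) (ε : ℝ) :
    Set ((Fin n → S) → A → ℝ) :=
  {x | IsMechanism x ∧ ∀ i, ∀ φ ∈ Φ, G.devUtility φ i x - G.utility G.uS x ≤ ε}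

/-- Receiver's utility of an optimal IC mechanism. -/
def Game.optValue (G : Game Θ S A) (n : ℕ) (Φ : Set (S → S)) : ℝ :=
  sSup (G.utility G.uR '' G.icSet n Φ 0)

/-- An optimal IC mechanism exists, and `optValue` is its utility for the receiver. -/
theorem isGreatest_optValue [Nonempty A] (G : Game Θ S A) (Φ : Set (S → S)) :
    IsGreatest (G.utility G.uR '' G.icSet n Φ 0) (G.optValue n Φ) := by
  classical
  have hc : IsCompact (G.icSet n Φ 0) := by
    have h1 : IsCompact {x : (Fin n → S) → A → ℝ | ∀ s, x s ∈ stdSimplex ℝ A} := by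
      have := isCompact_univ_pi (fun _ : Fin n → S => isCompact_stdSimplex ℝ A)
      convert this using 1
      ext x; simp
    have h2 : IsClosed {x : (Fin n → S) → A → ℝ |
        ∀ i, ∀ φ ∈ Φ, G.devUtility φ i x - G.utility G.uS x ≤ 0} := by
      simp only [Set.ofPred_forall]
      refine isClosed_iInter fun i => isClosed_iInter fun φ => isClosed_iInter fun _ => ?_
      refine isClosed_le ?_ continuous_const
      unfold Game.devUtility Game.utility
      fun_prop
    exact h1.inter_right h2
  have hne : (G.icSet n Φ 0).Nonempty := by
    obtain ⟨a⟩ := ‹Nonempty A›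
    refine ⟨fun _ => Pi.single a 1, fun s => single_mem_stdSimplex ℝ a, fun i φ _ => ?_⟩
    simp [Game.devUtility, Game.utility]
  have hcont : Continuous (G.utility G.uR (n := n)) := by
    unfold Game.utility; fun_prop
  exact (hc.image hcont).isGreatest_sSup (hne.image _)

/-- Largest gain of a sender from a deviation in `Φ`; the gain of a fixed deviation is the same
for all senders when the mechanism is symmetric. -/
def Game.violation (G : Game Θ S A) (Φ : Set (S → S)) (x : (Fin n → S) → A → ℝ) : ℝ :=
  ⨆ q : Fin n × Φ, (G.devUtility q.2.1 q.1 x - G.utility G.uS x)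

end Static

/-- Ex-ante deviations: the report does not depend on the observed signal. -/
def exAnte (S : Type) : Set (S → S) := {φ | ∀ s s', φ s = φ s'}

/-- Deviations that misreport at most one signal; they generate all ex-interim deviations. -/
def singleSignal (S : Type) : Set (S → S) := {φ | ∃ s, ∀ s', s' ≠ s → φ s' = s'}

/-- Bandit feedback of one round: signal profile, action, senders' payoff, receiver's payoff. -/
abbrev Feedback (n : ℕ) (S A : Type) : Type := (Fin n → S) × A × ℝ × ℝ

/-- A randomized algorithm of the receiver for horizon `T`: after drawing an internal seed, it
chooses in round `t` a symmetric mechanism from the seed and the feedback of earlier rounds. -/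
structure Policy (n : ℕ) (S A : Type) [Fintype A] (T : ℕ) where
  Seed : Type
  [seedSpace : MeasurableSpace Seed]
  seedLaw : Measure Seed
  [seedProb : IsProbabilityMeasure seedLaw]
  choose : (t : Fin T) → Seed → (Fin t → Feedback n S A) → SymMechanism n S A
  choose_measurable : ∀ t h c a, Measurable fun ω => (choose t ω h c : A → ℝ) a

attribute [instance] Policy.seedSpace Policy.seedProb

/-- A full record of `T` rounds: state of nature, signal profile and action of every round. -/
def Trajectory (n : ℕ) (Θ S A : Type) (T : ℕ) : Type := Fin T → Θ × (Fin n → S) × A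

instance (n : ℕ) (Θ S A : Type) (T : ℕ) : MeasurableSpace (Trajectory n Θ S A T) := ⊤

instance (n : ℕ) (Θ S A : Type) (T : ℕ) : DiscreteMeasurableSpace (Trajectory n Θ S A T) :=
  ⟨fun _ => trivial⟩

instance (n : ℕ) (Θ S A : Type) [Fintype Θ] [Fintype S] [Fintype A] (T : ℕ) :
    Finite (Trajectory n Θ S A T) :=
  inferInstanceAs (Finite (Fin T → Θ × (Fin n → S) × A))

theorem sum_prod_prefix {X : Type} [Fintype X] : ∀ (T : ℕ)
    (g : (t : Fin T) → (Fin t → X) → X → ℝ) (_ : ∀ t h, ∑ x, g t h x = 1),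
    ∑ τ : Fin T → X, ∏ t, g t (fun k => τ ⟨k, k.2.trans t.2⟩) (τ t) = 1 := by
  intro T
  induction T with
  | zero => intro g _; simp
  | succ T ih =>
    intro g hg
    rw [← (Fin.snocEquiv (fun _ => X)).sum_comp, Fintype.sum_prod_type_right]
    rw [← ih (fun t h x => g t.castSucc h x) (fun t h => hg t.castSucc h)]
    refine Finset.sum_congr rfl fun τ _ => ?_
    simp only [Fin.prod_univ_castSucc]
    have h1 : ∀ x : X, (∏ t : Fin T, g t.castSucc
        (fun k => (Fin.snocEquiv (fun _ => X)) (x, τ) ⟨k, k.2.trans t.castSucc.2⟩)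
        ((Fin.snocEquiv (fun _ => X)) (x, τ) t.castSucc)) =
        ∏ t : Fin T, g t.castSucc (fun k => τ ⟨k, k.2.trans t.2⟩) (τ t) := by
      intro x
      refine Finset.prod_congr rfl fun t _ => ?_
      congr 1
      · funext k
        have : (⟨k, k.2.trans t.castSucc.2⟩ : Fin (T+1)) =
          Fin.castSucc ⟨k, k.2.trans t.2⟩ := rfl
        rw [this]; exact Fin.snoc_castSucc (α := fun _ => X) _ _ _
      · simp [Fin.snocEquiv]
    simp only [h1]
    rw [← Finset.mul_sum]
    have h2 : ∀ x : X, g (Fin.last T)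
        (fun k => (Fin.snocEquiv (fun _ => X)) (x, τ) ⟨k, k.2.trans (Fin.last T).2⟩)
        ((Fin.snocEquiv (fun _ => X)) (x, τ) (Fin.last T)) = g (Fin.last T) τ x := by
      intro x
      congr 1
      · funext k
        have : (⟨k, k.2.trans (Fin.last T).2⟩ : Fin (T+1)) = Fin.castSucc ⟨k, k.2⟩ := rfl
        rw [this]; exact Fin.snoc_castSucc (α := fun _ => X) _ _ _
      · simp [Fin.snocEquiv]
    simp only [h2, hg, mul_one]
    rfl

section Online

variable {n T : ℕ} {Θ S A : Type} [Fintype Θ] [Fintype S] [Fintype A]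

/-- What the receiver has seen before round `t`. -/
def Game.feedback (G : Game Θ S A) (τ : Trajectory n Θ S A T) (t : Fin T) :
    Fin t → Feedback n S A :=
  fun k =>
    let o := τ ⟨k, k.2.trans t.2⟩
    (o.2.1, o.2.2, G.uS o.2.2 o.1, G.uR o.2.2 o.1)

/-- The symmetric mechanism that the algorithm selects in round `t`. -/
def Policy.selected (π : Policy n S A T) (G : Game Θ S A)
    (q : π.Seed × Trajectory n Θ S A T) (t : Fin T) : SymMechanism n S A :=
  π.choose t q.1 (G.feedback q.2 t)

/-- Conditional probability of the trajectory given the seed: in each round the state is drawn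
from the prior, the signals independently given the state, the action from the mechanism. -/
def Policy.weight (π : Policy n S A T) (G : Game Θ S A)
    (q : π.Seed × Trajectory n Θ S A T) : ℝ :=
  ∏ t : Fin T, G.prior (q.2 t).1 * (∏ j, G.signal (q.2 t).1 ((q.2 t).2.1 j)) *
    (π.selected G q t).toMechanism (q.2 t).2.1 (q.2 t).2.2

/-- Joint law of the seed and the trajectory when the algorithm plays the game. -/
def Policy.law (π : Policy n S A T) (G : Game Θ S A) :
    Measure (π.Seed × Trajectory n Θ S A T) :=
  (π.seedLaw.prod Measure.count).withDensity fun q => ENNReal.ofReal (π.weight G q)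

instance : Fintype (Trajectory n Θ S A T) := by
  classical exact inferInstanceAs (Fintype (Fin T → Θ × (Fin n → S) × A))

theorem weight_sum (π : Policy n S A T) (G : Game Θ S A) (ω : π.Seed) :
    ∑ τ, π.weight G (ω, τ) = 1 := by
  classical
  have := sum_prod_prefix (X := Θ × (Fin n → S) × A) T (fun t h x =>
    G.prior x.1 * (∏ j, G.signal x.1 (x.2.1 j)) *
    (π.choose t ω (fun k => ((h k).2.1, (h k).2.2, G.uS (h k).2.2 (h k).1, G.uR (h k).2.2 (h k).1))).toMechanism x.2.1 x.2.2) ?_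
  · refine Eq.trans ?_ this
    exact Fintype.sum_equiv (Equiv.refl _) _ _ fun τ => rfl
  intro t h
  simp only [Fintype.sum_prod_type]
  have : ∀ (ξ : SymMechanism n S A) s, ∑ a, ξ.toMechanism s a = 1 := fun ξ s => (ξ _).2.2
  simp only [← Finset.mul_sum, this, mul_one]
  have h3 : ∀ θ, ∑ s : Fin n → S, ∏ j, G.signal θ (s j) = 1 := by
    intro θ
    rw [← Fintype.prod_sum]
    simp [(G.signal_mem θ).2]
  simp only [h3, mul_one]
  exact G.prior_mem.2

theorem weight_nonneg (π : Policy n S A T) (G : Game Θ S A) (q) : 0 ≤ π.weight G q :=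
  Finset.prod_nonneg fun t _ => mul_nonneg (mul_nonneg (G.prior_mem.1 _)
    (Finset.prod_nonneg fun _ _ => (G.signal_mem _).1 _)) ((π.selected G q t _).2.1 _)

theorem weight_meas (π : Policy n S A T) (G : Game Θ S A) : Measurable (π.weight G) := by
  refine measurable_from_prod_countable_left fun τ => ?_
  unfold Policy.weight
  refine Finset.measurable_prod _ fun t _ => ?_
  exact (π.choose_measurable t (G.feedback τ t) (profileClass (τ t).2.1) (τ t).2.2).const_mul
    (G.prior (τ t).1 * ∏ j, G.signal (τ t).1 ((τ t).2.1 j))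

instance (π : Policy n S A T) (G : Game Θ S A) : IsProbabilityMeasure (π.law G) := by
  constructor
  have hm := (weight_meas π G).ennreal_ofReal
  rw [Policy.law, withDensity_apply _ MeasurableSet.univ, Measure.restrict_univ,
    lintegral_prod _ hm.aemeasurable]
  have : ∀ ω, ∫⁻ τ, ENNReal.ofReal (π.weight G (ω, τ)) ∂Measure.count = 1 := by
    intro ω
    rw [lintegral_count, tsum_fintype, ← ENNReal.ofReal_sum_of_nonneg, weight_sum]
    · simp
    · intro τ _; exact weight_nonneg π G _
  simp [this]

/-- Cumulative regret with respect to an optimal IC mechanism. -/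
def Policy.regret (π : Policy n S A T) (G : Game Θ S A) (Φ : Set (S → S))
    (q : π.Seed × Trajectory n Θ S A T) : ℝ :=
  ∑ t, (G.optValue n Φ - G.utility G.uR (π.selected G q t).toMechanism)

/-- Cumulative IC violation. -/
def Policy.cumViolation (π : Policy n S A T) (G : Game Θ S A) (Φ : Set (S → S))
    (q : π.Seed × Trajectory n Θ S A T) : ℝ :=
  ∑ t, G.violation Φ (π.selected G q t).toMechanism

end Online

/-- The algorithm (one policy per horizon) achieves `R^T = o(T^α)` and `V^T = o(T^(1-α/2))`
simultaneously with probability greater than `1 - δ`, whatever the unknown game is. -/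
def Achieves {n : ℕ} (Θ : Type) {S A : Type} [Fintype Θ] [Fintype S] [Fintype A]
    (Φ : Set (S → S)) (alg : (T : ℕ) → Policy n S A T) (α δ : ℝ) : Prop :=
  ∃ r v : ℕ → ℝ,
    r =o[atTop] (fun T : ℕ => (T : ℝ) ^ α) ∧
    v =o[atTop] (fun T : ℕ => (T : ℝ) ^ (1 - α / 2)) ∧
    ∀ᶠ T in atTop, ∀ G : Game Θ S A,
      1 - δ < ((alg T).law G).real
        {q | (alg T).regret G Φ q ≤ r T ∧ (alg T).cumViolation G Φ q ≤ v T}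

end

end InfoAcq

/-! Two instances with a single sender are hard to tell apart but call for different behaviour. In
`biasGame 0` the sender's conditional mean payoffs are all equal, so every mechanism is IC and small
regret forces the action to match the signal. In `biasGame e` with `e > 0` a sender who sees signal
`0` prefers action `1`, so a mechanism that matches actions to signals leaves a gain of order `e`
from always reporting `1`.

Only the prior of the states `0` and `1` differs between the games. These states share a signal, and
their payoffs differ only under action `1`, which is then a mismatch. Exploration is thus paid for
by regret in `biasGame 0`, and `D` expected mismatches yield information of order `e ^ 2 * D`.
Regret `o(T^α)` gives `D = o(T^α)`; for `e` of order `T^(-α/2)` the information vanishes, matching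
persists under `biasGame e` with probability bounded below, and the violation has order `e * T`,
that is `T^(1-α/2)`.

The comparison of laws rests on `sq_sum_prod_le`, a chi-square bound in terms of accumulated
information, and on `sum_mul_prod_congr_of_coarsening`, which removes the contribution of unobserved
states. They combine in `sq_sum_weight_le`. -/

namespace InfoAcq

/-! ### Change of measure for adaptively generated sequences -/

section Likelihood

variable {X : Type} [Fintype X]

/-- Sums over sequences of a function that factors through an idempotent coarsening `c` do not
change when the product weight is replaced by one with the same mass on the fibres of `c`. -/
theorem sum_mul_prod_congr_of_coarsening (c : X → X) (hc : ∀ x, c (c x) = c x) (h h' : X → ℝ)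
    (hh : ∀ f : X → ℝ, (∀ x, f (c x) = f x) → ∑ x, f x * h x = ∑ x, f x * h' x)
    {T : ℕ} (F : (Fin T → X) → ℝ) (hF : ∀ τ, F (fun t => c (τ t)) = F τ) :
    ∑ τ : Fin T → X, F τ * ∏ t, h (τ t) = ∑ τ : Fin T → X, F τ * ∏ t, h' (τ t) := by
  classical
  -- Group the sequences by their image under `c`: `F` is constant on each group, and the product
  -- weight of a group factors into fibre masses.
  have key : ∀ g : X → ℝ, ∑ τ : Fin T → X, F τ * ∏ t, g (τ t) =
      ∑ o : Fin T → X, F o * ∏ t, ∑ x, (if c x = o t then 1 else 0) * g x := by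
    intro g
    simp_rw [Fintype.prod_sum, Finset.mul_sum]
    rw [Finset.sum_comm]
    refine Finset.sum_congr rfl fun τ _ => ?_
    rw [Finset.sum_eq_single (fun t => c (τ t))]
    · simp [hF]
    · intro o _ ho
      obtain ⟨t, ht⟩ : ∃ t, c (τ t) ≠ o t := by
        by_contra! H
        exact ho (funext fun t => (H t).symm)
      rw [Finset.prod_eq_zero (Finset.mem_univ t) (by simp [ht]), mul_zero]
    · simp
  rw [key, key]
  refine Finset.sum_congr rfl fun o _ => ?_
  congr 1
  refine Finset.prod_congr rfl fun t _ => ?_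
  exact hh (fun x => if c x = o t then 1 else 0) fun x => by simp [hc]

/-- Chi-square change of measure for adaptively generated sequences: on an event where the
accumulated conditional second moments are at most `C`, the squared probability under the weights
`h` is at most `C` times the probability under the weights `h'`. -/
theorem sq_sum_prod_le {T : ℕ} (h h' : X → ℝ) (hpos : ∀ x, 0 < h' x)
    (k : (t : Fin T) → (Fin t → X) → X → ℝ) (hk : ∀ t l x, 0 ≤ k t l x)
    (b : (t : Fin T) → (Fin t → X) → ℝ) (hb : ∀ t l, 0 < b t l)
    (hsum : ∀ t l, ∑ x, h x ^ 2 / h' x * k t l x = b t l) (C : ℝ) (hC : 0 ≤ C)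
    (E : Finset (Fin T → X))
    (hE : ∀ τ ∈ E, ∏ t, b t (fun j => τ ⟨j, j.2.trans t.2⟩) ≤ C) :
    (∑ τ ∈ E, ∏ t, h (τ t) * k t (fun j => τ ⟨j, j.2.trans t.2⟩) (τ t)) ^ 2 ≤
      C * ∑ τ ∈ E, ∏ t, h' (τ t) * k t (fun j => τ ⟨j, j.2.trans t.2⟩) (τ t) := by
  classical
  have hq : ∀ x, 0 ≤ h x ^ 2 / h' x := fun x => div_nonneg (sq_nonneg _) (hpos x).le
  have hf0 : ∀ τ : Fin T → X, 0 ≤ ∏ t, h' (τ t) * k t (fun j => τ ⟨j, j.2.trans t.2⟩) (τ t) :=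
    fun τ => Finset.prod_nonneg fun t _ => mul_nonneg (hpos _).le (hk _ _ _)
  have hg0 : ∀ τ : Fin T → X,
      0 ≤ ∏ t, h (τ t) ^ 2 / h' (τ t) * k t (fun j => τ ⟨j, j.2.trans t.2⟩) (τ t) :=
    fun τ => Finset.prod_nonneg fun t _ => mul_nonneg (hq _) (hk _ _ _)
  -- Cauchy–Schwarz, with `h * k` as the geometric mean of `h' * k` and `h ^ 2 / h' * k`.
  have hCS := Finset.sum_sq_le_sum_mul_sum_of_sq_le_mul E (fun τ _ => hf0 τ) (fun τ _ => hg0 τ)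
    (r := fun τ => ∏ t, h (τ t) * k t (fun j => τ ⟨j, j.2.trans t.2⟩) (τ t)) (by
      intro τ _
      refine le_of_eq ?_
      rw [← Finset.prod_pow, ← Finset.prod_mul_distrib]
      refine Finset.prod_congr rfl fun t _ => ?_
      have := (hpos (τ t)).ne'
      field_simp)
  refine hCS.trans ?_
  rw [mul_comm]
  refine mul_le_mul_of_nonneg_right ?_ (Finset.sum_nonneg fun τ _ => hf0 τ)
  -- Division by `b` turns the second-moment weights into a probability on sequences; on `E` the
  -- normalization costs at most `C`.
  have hone := sum_prod_prefix T (fun t l x => h x ^ 2 / h' x * k t l x / b t l) (by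
    intro t l
    rw [← Finset.sum_div, hsum, div_self (hb t l).ne'])
  simp only [Finset.prod_div_distrib] at hone
  have hB : ∀ τ : Fin T → X, 0 < ∏ t, b t (fun j => τ ⟨j, j.2.trans t.2⟩) :=
    fun τ => Finset.prod_pos fun t _ => hb _ _
  calc _ ≤ ∑ τ ∈ E, C * ((∏ t, h (τ t) ^ 2 / h' (τ t) *
            k t (fun j => τ ⟨j, j.2.trans t.2⟩) (τ t)) /
            ∏ t, b t (fun j => τ ⟨j, j.2.trans t.2⟩)) := by
        refine Finset.sum_le_sum fun τ hτ => ?_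
        rw [← mul_div_assoc, le_div_iff₀ (hB τ), mul_comm]
        exact mul_le_mul_of_nonneg_right (hE τ hτ) (hg0 τ)
    _ ≤ C * 1 := by
        rw [← Finset.mul_sum, ← hone]
        refine mul_le_mul_of_nonneg_left ?_ hC
        exact Finset.sum_le_univ_sum_of_nonneg fun τ => div_nonneg (hg0 τ) (hB τ).le
    _ = C := mul_one C

end Likelihood

/-! ### The law of play as an average over the seed -/

section Law

variable {n T : ℕ} {Θ S A : Type} [Fintype Θ] [Fintype S] [Fintype A]

open Classical in
/-- Probability of an event as an average over the seed. -/
theorem Policy.law_apply (π : Policy n S A T) (G : Game Θ S A)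
    {E : Set (π.Seed × Trajectory n Θ S A T)} (hE : MeasurableSet E) :
    π.law G E = ∫⁻ ω, ENNReal.ofReal
      (∑ τ ∈ Finset.univ.filter (fun τ => (ω, τ) ∈ E), π.weight G (ω, τ)) ∂π.seedLaw := by
  have hm := (weight_meas π G).ennreal_ofReal
  rw [Policy.law, withDensity_apply _ hE, ← lintegral_indicator hE,
    lintegral_prod _ (hm.indicator hE).aemeasurable]
  refine lintegral_congr fun ω => ?_
  rw [lintegral_count, tsum_fintype,
    ENNReal.ofReal_sum_of_nonneg (fun τ _ => weight_nonneg π G _), Finset.sum_filter]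
  refine Finset.sum_congr rfl fun τ _ => ?_
  simp [Set.indicator]

/-- Functions of the mechanisms chosen in the single rounds are measurable. -/
theorem Policy.measurable_selected (π : Policy n S A T) (G : Game Θ S A) (t : Fin T)
    (s : Fin n → S) (a : A) : Measurable fun q => (π.selected G q t).toMechanism s a := by
  refine measurable_from_prod_countable_left fun τ => ?_
  exact π.choose_measurable t (G.feedback τ t) (profileClass s) a

end Law
end InfoAcq

/-! ### The hard instances -/

namespace InfoAcq

noncomputable section

/-- One sender, three states, two signals, two actions. The signal reveals whether the state is
`2`; the receiver wants the action to match the signal. The states `0` and `1` differ only in the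
senders' payoff of action `1`, which has the mean `(1 + e) / 2` given the signal `0`; all other
conditional means of the senders' payoff are `1 / 2`. -/
def biasGame (e : ℝ) (he : e ∈ Set.Icc (0 : ℝ) (1 / 2)) : Game (Fin 3) (Fin 2) (Fin 2) where
  prior := ![(1 - e) / 4, (1 + e) / 4, 1 / 2]
  prior_mem := by
    obtain ⟨h0, h1⟩ := he
    refine ⟨fun θ => ?_, ?_⟩
    · fin_cases θ <;> simp <;> linarith
    · simp [Fin.sum_univ_three]; ring
  signal := fun θ => Pi.single (if θ = 2 then 1 else 0) 1
  signal_mem := fun θ => single_mem_stdSimplex ℝ _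
  uR := fun a θ => if a = (if θ = 2 then 1 else 0) then 1 else 0
  uR_mem := fun a θ => by split_ifs <;> simp
  uS := fun a θ => if a = 1 then ![0, 1, 1 / 2] θ else 1 / 2
  uS_mem := fun a θ => by
    constructor <;> fin_cases θ <;> fin_cases a <;> norm_num

variable {e : ℝ} (he : e ∈ Set.Icc (0 : ℝ) (1 / 2))

theorem sum_profile_one {M : Type} [AddCommMonoid M] (f : (Fin 1 → Fin 2) → M) :
    ∑ s, f s = f (fun _ => 0) + f (fun _ => 1) := by
  rw [← (Equiv.funUnique (Fin 1) (Fin 2)).symm.sum_comp, Fin.sum_univ_two]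
  rfl

theorem biasGame_utility_uR (x : (Fin 1 → Fin 2) → Fin 2 → ℝ) :
    (biasGame e he).utility (biasGame e he).uR x =
      (x (fun _ => 0) 0 + x (fun _ => 1) 1) / 2 := by
  simp [Game.utility, biasGame, sum_profile_one, Fin.sum_univ_three]
  ring

theorem biasGame_utility_uS (x : (Fin 1 → Fin 2) → Fin 2 → ℝ) (hx : IsMechanism x) :
    (biasGame e he).utility (biasGame e he).uS x =
      1 / 2 + e / 4 * x (fun _ => 0) 1 := by
  have h0 := (hx fun _ => 0).2
  have h1 := (hx fun _ => 1).2
  rw [Fin.sum_univ_two] at h0 h1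
  simp [Game.utility, biasGame, sum_profile_one, Fin.sum_univ_three]
  linear_combination h0 / 4 + h1 / 4

/-- With one sender, a deviation amounts to truthful play of the mechanism precomposed with `φ`. -/
theorem biasGame_devUtility (φ : Fin 2 → Fin 2) (i : Fin 1) (x : (Fin 1 → Fin 2) → Fin 2 → ℝ)
    (hx : IsMechanism x) :
    (biasGame e he).devUtility φ i x = 1 / 2 + e / 4 * x (fun _ => φ 0) 1 := by
  rw [← biasGame_utility_uS he (fun s => x fun _ => φ (s 0)) fun s => hx _]
  unfold Game.devUtility Game.utility
  have : ∀ s : Fin 1 → Fin 2, Function.update s i (φ (s i)) = fun _ => φ (s 0) := by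
    intro s
    funext j
    rw [Subsingleton.elim i 0, Subsingleton.elim j 0, Function.update_self]
  simp_rw [this]

theorem isMechanism_toMechanism {n : ℕ} {S A : Type} [Fintype A] (ξ : SymMechanism n S A) :
    IsMechanism ξ.toMechanism := fun s => (ξ (profileClass s)).2

/-- Total probability with which a mechanism fails to match the action to the signal. -/
def mismatch (x : (Fin 1 → Fin 2) → Fin 2 → ℝ) : ℝ := x (fun _ => 0) 1 + x (fun _ => 1) 0

theorem one_le_optValue_biasGame_zero (h : (0 : ℝ) ∈ Set.Icc (0 : ℝ) (1 / 2))
    (Φ : Set (Fin 2 → Fin 2)) : 1 ≤ (biasGame 0 h).optValue 1 Φ := by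
  -- Playing the signal as the action is IC, since at `e = 0` truthful and deviating utility both
  -- equal `1 / 2`.
  refine (isGreatest_optValue (n := 1) (biasGame 0 h) Φ).2 ⟨fun s => Pi.single (s 0) 1, ?_, ?_⟩
  · have hx : IsMechanism (n := 1) fun s : Fin 1 → Fin 2 => (Pi.single (s 0) 1 : Fin 2 → ℝ) :=
      fun s => single_mem_stdSimplex ℝ _
    refine ⟨hx, fun i φ _ => ?_⟩
    rw [biasGame_devUtility h φ i _ hx, biasGame_utility_uS h _ hx]
    simp
  · rw [biasGame_utility_uR]
    simp

theorem half_mismatch_le_regret_biasGame_zero (h : (0 : ℝ) ∈ Set.Icc (0 : ℝ) (1 / 2))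
    (Φ : Set (Fin 2 → Fin 2)) {x : (Fin 1 → Fin 2) → Fin 2 → ℝ} (hx : IsMechanism x) :
    mismatch x / 2 ≤ (biasGame 0 h).optValue 1 Φ - (biasGame 0 h).utility (biasGame 0 h).uR x := by
  have h0 := (hx fun _ => 0).2
  have h1 := (hx fun _ => 1).2
  rw [Fin.sum_univ_two] at h0 h1
  rw [biasGame_utility_uR, mismatch]
  linarith [one_le_optValue_biasGame_zero h Φ]

/-- The deviation to the constant report `1` raises the probability of action `1` at signal `0` from
`x (fun _ => 0) 1` to `x (fun _ => 1) 1`; the difference is one minus the mismatch. -/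
theorem le_violation_biasGame {Φ : Set (Fin 2 → Fin 2)} (hΦ : (fun _ => 1) ∈ Φ)
    {x : (Fin 1 → Fin 2) → Fin 2 → ℝ} (hx : IsMechanism x) :
    e / 4 * (1 - mismatch x) ≤ (biasGame e he).violation Φ x := by
  have h1 := (hx fun _ => 1).2
  rw [Fin.sum_univ_two] at h1
  have := le_ciSup (f := fun q : Fin 1 × Φ => (biasGame e he).devUtility q.2.1 q.1 x -
    (biasGame e he).utility (biasGame e he).uS x) (Set.finite_range _).bddAbove
    (0, ⟨fun _ => 1, hΦ⟩)
  refine le_trans (le_of_eq ?_) this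
  simp only
  rw [biasGame_devUtility he _ _ x hx, biasGame_utility_uS he x hx, mismatch]
  linear_combination (-(e / 4)) * h1

/-! ### Masking the states that the feedback does not reveal -/

/-- Merges the states `0` and `1` in the rounds in which the feedback does not separate them. -/
def mergeStates (x : Fin 3 × (Fin 1 → Fin 2) × Fin 2) : Fin 3 × (Fin 1 → Fin 2) × Fin 2 :=
  (if x.1 = 1 ∧ x.2.2 = 0 then 0 else x.1, x.2)

/-- The prior of `biasGame e` in the rounds with informative feedback, and the prior of
`biasGame 0` in the others. -/
def maskedPrior (e : ℝ) (x : Fin 3 × (Fin 1 → Fin 2) × Fin 2) : ℝ :=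
  if x.2.2 = 0 then ![1 / 4, 1 / 4, 1 / 2] x.1 else ![(1 - e) / 4, (1 + e) / 4, 1 / 2] x.1

/-- Merged states contribute only through the sum of their priors, which is `1 / 2` for every `e`.
-/
theorem sum_mul_prior_eq_sum_mul_maskedPrior (f : Fin 3 × (Fin 1 → Fin 2) × Fin 2 → ℝ)
    (hf : ∀ x, f (mergeStates x) = f x) :
    ∑ x, f x * (biasGame e he).prior x.1 = ∑ x, f x * maskedPrior e x := by
  have h : ∀ s, f (1, s, 0) = f (0, s, 0) := fun s => by simpa [mergeStates] using (hf (1, s, 0)).symm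
  simp [Fintype.sum_prod_type, Fin.sum_univ_three, Fin.sum_univ_two, maskedPrior, biasGame,
    sum_profile_one, h]
  ring

theorem maskedPrior_pos (he : e ∈ Set.Icc (0 : ℝ) (1 / 2)) (x : Fin 3 × (Fin 1 → Fin 2) × Fin 2) : 0 < maskedPrior e x := by
  obtain ⟨h0, h1⟩ := he
  obtain ⟨θ, s, a⟩ := x
  fin_cases θ <;> fin_cases a <;> simp [maskedPrior] <;> linarith

/-- Conditional probability of signals and action given the state, for a chosen mechanism. -/
def stepKernel (x : (Fin 1 → Fin 2) → Fin 2 → ℝ) (o : Fin 3 × (Fin 1 → Fin 2) × Fin 2) : ℝ :=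
  (∏ j, (Pi.single (if o.1 = 2 then 1 else 0) 1 : Fin 2 → ℝ) (o.2.1 j)) * x o.2.1 o.2.2

theorem stepKernel_nonneg {x : (Fin 1 → Fin 2) → Fin 2 → ℝ} (hx : IsMechanism x)
    (o : Fin 3 × (Fin 1 → Fin 2) × Fin 2) : 0 ≤ stepKernel x o :=
  mul_nonneg (Finset.prod_nonneg fun _ _ => (single_mem_stdSimplex ℝ _).1 _) ((hx _).1 _)

/-- Without masking every round with signal `0` would contribute, for a total of order `e ^ 2 * T`.
With it, the only excess over `1` comes from action `1` at signal `0`. -/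
theorem sum_sq_div_maskedPrior_mul_stepKernel (he : e ∈ Set.Icc (0 : ℝ) (1 / 2))
    {x : (Fin 1 → Fin 2) → Fin 2 → ℝ}
    (hx : IsMechanism x) :
    ∑ o, ((![1 / 4, 1 / 4, 1 / 2] : Fin 3 → ℝ) o.1) ^ 2 / maskedPrior e o * stepKernel x o =
      1 + x (fun _ => 0) 1 / 2 * (e ^ 2 / (1 - e ^ 2)) := by
  have h0 := (hx fun _ => 0).2
  have h1 := (hx fun _ => 1).2
  rw [Fin.sum_univ_two] at h0 h1
  obtain ⟨he0, he1⟩ := he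
  have e1 : 1 - e ≠ 0 := by linarith
  have e2 : 1 + e ≠ 0 := by linarith
  have e3 : 1 - e ^ 2 ≠ 0 := by
    rw [show 1 - e ^ 2 = (1 - e) * (1 + e) by ring]; exact mul_ne_zero e1 e2
  have h0' : x (fun _ => 0) 0 = 1 - x (fun _ => 0) 1 := by linarith
  have h1' : x (fun _ => 1) 0 = 1 - x (fun _ => 1) 1 := by linarith
  simp [Fintype.sum_prod_type, Fin.sum_univ_three, maskedPrior, stepKernel,
    sum_profile_one, h0', h1']
  field_simp
  ring

end

end InfoAcq

/-! ### Comparison of the two laws of play -/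

namespace InfoAcq

noncomputable section

section Comparison

variable {T : ℕ} (π : Policy 1 (Fin 2) (Fin 2) T)

/-- Under action `0` the states `0` and `1` produce identical payoffs, so merging them leaves the
feedback unchanged. -/
theorem selected_biasGame_mergeStates {e : ℝ} (he : e ∈ Set.Icc (0 : ℝ) (1 / 2)) (ω : π.Seed)
    (τ : Trajectory 1 (Fin 3) (Fin 2) (Fin 2) T) (t : Fin T) :
    π.selected (biasGame e he) (ω, fun t => mergeStates (τ t)) t =
      π.selected (biasGame e he) (ω, τ) t := by
  unfold Policy.selected
  congr 1
  funext k
  simp only [Game.feedback]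
  obtain ⟨θ, s, a⟩ := τ ⟨k, k.2.trans t.2⟩
  fin_cases θ <;> fin_cases a <;> simp [mergeStates, biasGame]

theorem stepKernel_mergeStates (x : (Fin 1 → Fin 2) → Fin 2 → ℝ)
    (o : Fin 3 × (Fin 1 → Fin 2) × Fin 2) : stepKernel x (mergeStates o) = stepKernel x o := by
  obtain ⟨θ, s, a⟩ := o
  fin_cases θ <;> fin_cases a <;> simp [mergeStates, stepKernel]

theorem weight_biasGame {e : ℝ} (he : e ∈ Set.Icc (0 : ℝ) (1 / 2))
    (q : π.Seed × Trajectory 1 (Fin 3) (Fin 2) (Fin 2) T) :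
    π.weight (biasGame e he) q = (∏ t, (biasGame e he).prior (q.2 t).1) *
      ∏ t, stepKernel (π.selected (biasGame e he) q t).toMechanism (q.2 t) := by
  rw [← Finset.prod_mul_distrib]
  refine Finset.prod_congr rfl fun t _ => ?_
  rw [mul_assoc]
  rfl

/-- Records on which the selected mechanisms fail to match action and signal at most `D` times
in conditional expectation. -/
def fewMismatches {e : ℝ} (he : e ∈ Set.Icc (0 : ℝ) (1 / 2)) (D : ℝ) :
    Set (π.Seed × Trajectory 1 (Fin 3) (Fin 2) (Fin 2) T) :=
  {q | ∑ t, mismatch (π.selected (biasGame e he) q t).toMechanism ≤ D}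

theorem measurableSet_fewMismatches {e : ℝ} (he : e ∈ Set.Icc (0 : ℝ) (1 / 2)) (D : ℝ) :
    MeasurableSet (fewMismatches π he D) := by
  refine measurableSet_le (Finset.measurable_sum _ fun t _ => ?_) measurable_const
  exact (π.measurable_selected _ t _ _).add (π.measurable_selected _ t _ _)

open Classical in
-- For a fixed seed: the chi-square bound compares the prior at `e = 0` with the masked prior, and
-- coarsening then replaces the masked prior by that of `biasGame e`.
theorem sq_sum_weight_le {e : ℝ} (h : (0 : ℝ) ∈ Set.Icc (0 : ℝ) (1 / 2))
    (he : e ∈ Set.Icc (0 : ℝ) (1 / 2)) (D : ℝ) (ω : π.Seed) :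
    (∑ τ ∈ Finset.univ.filter (fun τ => (ω, τ) ∈ fewMismatches π he D),
        π.weight (biasGame 0 h) (ω, τ)) ^ 2 ≤
      Real.exp (e ^ 2 * D) *
        ∑ τ ∈ Finset.univ.filter (fun τ => (ω, τ) ∈ fewMismatches π he D),
          π.weight (biasGame e he) (ω, τ) := by
  obtain ⟨he0, he1⟩ := id he
  let ξ : (t : Fin T) → (Fin t → Fin 3 × (Fin 1 → Fin 2) × Fin 2) → (Fin 1 → Fin 2) → Fin 2 → ℝ :=
    fun t l => (π.choose t ω fun k => ((l k).2.1, (l k).2.2,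
      (biasGame e he).uS (l k).2.2 (l k).1, (biasGame e he).uR (l k).2.2 (l k).1)).toMechanism
  have hξ : ∀ t l, IsMechanism (ξ t l) := fun t l => isMechanism_toMechanism _
  have hratio : 0 ≤ e ^ 2 / (1 - e ^ 2) := div_nonneg (sq_nonneg _) (by nlinarith)
  -- Since `e ≤ 1 / 2`, one has `1 - e ^ 2 ≥ 1 / 2`.
  have hratio' : e ^ 2 / (1 - e ^ 2) ≤ 2 * e ^ 2 := by
    rw [div_le_iff₀ (by nlinarith)]
    nlinarith [mul_nonneg (sq_nonneg e) (by nlinarith : (0 : ℝ) ≤ 1 - 2 * e ^ 2)]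
  have main := sq_sum_prod_le (T := T)
    (fun o : Fin 3 × (Fin 1 → Fin 2) × Fin 2 => (![1 / 4, 1 / 4, 1 / 2] : Fin 3 → ℝ) o.1)
    (maskedPrior e) (maskedPrior_pos he) (fun t l => stepKernel (ξ t l))
    (fun t l x => stepKernel_nonneg (hξ t l) x)
    (fun t l => 1 + ξ t l (fun _ => 0) 1 / 2 * (e ^ 2 / (1 - e ^ 2)))
    (fun t l => by
      have := (hξ t l fun _ => 0).1 1
      positivity)
    (fun t l => sum_sq_div_maskedPrior_mul_stepKernel he (hξ t l))
    (Real.exp (e ^ 2 * D)) (Real.exp_pos _).le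
    (Finset.univ.filter (fun τ => (ω, τ) ∈ fewMismatches π he D)) (by
      intro τ hτ
      have hD : ∑ t, mismatch (ξ t fun j => τ ⟨j, j.2.trans t.2⟩) ≤ D :=
        (Finset.mem_filter.1 hτ).2
      refine (Finset.prod_le_prod (g := fun t => Real.exp (e ^ 2 *
        mismatch (ξ t fun j => τ ⟨j, j.2.trans t.2⟩))) (fun t _ => ?_) fun t _ => ?_).trans ?_
      · have := (hξ t (fun j => τ ⟨j, j.2.trans t.2⟩) fun _ => 0).1 1
        positivity
      · have h1 := (hξ t (fun j => τ ⟨j, j.2.trans t.2⟩) fun _ => 0).1 1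
        have h2 := (hξ t (fun j => τ ⟨j, j.2.trans t.2⟩) fun _ => 1).1 0
        refine le_trans ?_ (Real.add_one_le_exp _)
        unfold mismatch
        nlinarith [mul_le_mul_of_nonneg_left hratio' h1, mul_nonneg (sq_nonneg e) h2]
      · rw [← Real.exp_sum, ← Finset.mul_sum]
        exact Real.exp_le_exp.2 (mul_le_mul_of_nonneg_left hD (sq_nonneg e)))
  simp only [Finset.prod_mul_distrib] at main
  -- The payoffs do not depend on `e`, so on a given record both games lead to the same mechanisms.
  have e0 : ∀ τ, π.weight (biasGame 0 h) (ω, τ) =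
      (∏ t, (![1 / 4, 1 / 4, 1 / 2] : Fin 3 → ℝ) (τ t).1) *
        ∏ t, stepKernel (ξ t fun j => τ ⟨j, j.2.trans t.2⟩) (τ t) := by
    intro τ
    rw [weight_biasGame]
    simp only [biasGame, sub_zero, add_zero]
    rfl
  simp only [e0]
  refine main.trans (le_of_eq ?_)
  congr 1
  rw [Finset.sum_filter, Finset.sum_filter]
  have hmerge := sum_mul_prod_congr_of_coarsening mergeStates
    (by rintro ⟨θ, s, a⟩; fin_cases θ <;> fin_cases a <;> simp [mergeStates])
    (fun x => (biasGame e he).prior x.1) (maskedPrior e)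
    (sum_mul_prior_eq_sum_mul_maskedPrior he) (T := T)
    (fun τ => if (ω, τ) ∈ fewMismatches π he D then
      ∏ t, stepKernel (π.selected (biasGame e he) (ω, τ) t).toMechanism (τ t) else 0) (by
      intro τ
      have := selected_biasGame_mergeStates π he ω τ
      have hmem : ((ω, fun t => mergeStates (τ t)) ∈ fewMismatches π he D) =
          ((ω, τ) ∈ fewMismatches π he D) := by
        change (∑ t, mismatch (π.selected (biasGame e he)
          (ω, fun t => mergeStates (τ t)) t).toMechanism ≤ D) =
          (∑ t, mismatch (π.selected (biasGame e he) (ω, τ) t).toMechanism ≤ D)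
        simp only [this]
      simp only [hmem, this, stepKernel_mergeStates])
  simp only [ite_mul, zero_mul] at hmerge
  refine Eq.trans (Eq.trans ?_ hmerge.symm) ?_
  · refine Finset.sum_congr rfl fun τ _ => ?_
    by_cases hτ : (ω, τ) ∈ fewMismatches π he D
    · exact (if_pos hτ).trans ((mul_comm _ _).trans (if_pos hτ).symm)
    · exact (if_neg hτ).trans (if_neg hτ).symm
  · refine Finset.sum_congr rfl fun τ _ => ?_
    by_cases hτ : (ω, τ) ∈ fewMismatches π he D
    · exact (if_pos hτ).trans (((weight_biasGame π he (ω, τ)).trans (mul_comm _ _)).symm.trans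
        (if_pos hτ).symm)
    · exact (if_neg hτ).trans (if_neg hτ).symm

/-- The inequality `2 * p ≤ 1 + p ^ 2` makes the bound for a fixed seed linear in the probabilities,
so that it can be integrated over the seed. -/
theorem two_mul_law_real_le {e : ℝ} (h : (0 : ℝ) ∈ Set.Icc (0 : ℝ) (1 / 2))
    (he : e ∈ Set.Icc (0 : ℝ) (1 / 2)) (D : ℝ) :
    2 * (π.law (biasGame 0 h)).real (fewMismatches π he D) ≤
      1 + Real.exp (e ^ 2 * D) * (π.law (biasGame e he)).real (fewMismatches π he D) := by
  classical
  have hE := measurableSet_fewMismatches π he D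
  have key : 2 * π.law (biasGame 0 h) (fewMismatches π he D) ≤
      1 + ENNReal.ofReal (Real.exp (e ^ 2 * D)) *
        π.law (biasGame e he) (fewMismatches π he D) := by
    rw [π.law_apply _ hE, π.law_apply _ hE, ← lintegral_const_mul' _ _ (by simp),
      ← lintegral_const_mul' _ _ (by simp)]
    calc _ ≤ ∫⁻ ω, (1 + ENNReal.ofReal (Real.exp (e ^ 2 * D)) * ENNReal.ofReal
          (∑ τ ∈ Finset.univ.filter (fun τ => (ω, τ) ∈ fewMismatches π he D),
            π.weight (biasGame e he) (ω, τ))) ∂π.seedLaw := by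
          refine lintegral_mono fun ω => ?_
          have hsq := sq_sum_weight_le π h he D ω
          have hn := Finset.sum_nonneg (s := Finset.univ.filter
            (fun τ => (ω, τ) ∈ fewMismatches π he D))
            fun τ _ => weight_nonneg π (biasGame e he) (ω, τ)
          rw [← ENNReal.ofReal_mul (Real.exp_pos _).le, ← ENNReal.ofReal_one,
            ← ENNReal.ofReal_add zero_le_one (mul_nonneg (Real.exp_pos _).le hn),
            ← ENNReal.ofReal_ofNat 2, ← ENNReal.ofReal_mul (by norm_num)]
          refine ENNReal.ofReal_le_ofReal ?_
          set p := ∑ τ ∈ Finset.univ.filter (fun τ => (ω, τ) ∈ fewMismatches π he D),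
            π.weight (biasGame 0 h) (ω, τ)
          nlinarith [sq_nonneg (p - 1)]
      _ = _ := by rw [lintegral_add_left measurable_const]; simp
  have := ENNReal.toReal_mono (by finiteness) key
  rw [ENNReal.toReal_add (by simp) (by finiteness), ENNReal.toReal_mul, ENNReal.toReal_mul,
    ENNReal.toReal_ofReal (Real.exp_pos _).le] at this
  simpa [Measure.real] using this

end Comparison

/-! ### Regret against violation, and the contradiction -/

/-- Under `biasGame 0`, small regret forces few mismatches. -/
theorem sum_mismatch_le_of_regret_le {T : ℕ} (π : Policy 1 (Fin 2) (Fin 2) T)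
    (h : (0 : ℝ) ∈ Set.Icc (0 : ℝ) (1 / 2)) (Φ : Set (Fin 2 → Fin 2)) {ρ : ℝ}
    {q : π.Seed × Trajectory 1 (Fin 3) (Fin 2) (Fin 2) T}
    (hq : π.regret (biasGame 0 h) Φ q ≤ ρ) :
    ∑ t, mismatch (π.selected (biasGame 0 h) q t).toMechanism ≤ 2 * ρ := by
  have : ∑ t, mismatch (π.selected (biasGame 0 h) q t).toMechanism / 2 ≤
      π.regret (biasGame 0 h) Φ q :=
    Finset.sum_le_sum fun t _ =>
      half_mismatch_le_regret_biasGame_zero h Φ (isMechanism_toMechanism _)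
  rw [← Finset.sum_div] at this
  linarith

/-- Under `biasGame e`, few mismatches force a large cumulative violation. -/
theorem le_cumViolation {T : ℕ} (π : Policy 1 (Fin 2) (Fin 2) T) {e : ℝ}
    (he : e ∈ Set.Icc (0 : ℝ) (1 / 2)) {Φ : Set (Fin 2 → Fin 2)} (hΦ : (fun _ => 1) ∈ Φ) {D : ℝ}
    {q : π.Seed × Trajectory 1 (Fin 3) (Fin 2) (Fin 2) T} (hq : q ∈ fewMismatches π he D) :
    e / 4 * (T - D) ≤ π.cumViolation (biasGame e he) Φ q := by
  have : ∑ t, e / 4 * (1 - mismatch (π.selected (biasGame e he) q t).toMechanism) ≤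
      π.cumViolation (biasGame e he) Φ q :=
    Finset.sum_le_sum fun t _ => le_violation_biasGame he hΦ (isMechanism_toMechanism _)
  refine le_trans ?_ this
  rw [← Finset.mul_sum, Finset.sum_sub_distrib]
  have hq' : ∑ t, mismatch (π.selected (biasGame e he) q t).toMechanism ≤ D := hq
  refine mul_le_mul_of_nonneg_left ?_ (by linarith [he.1])
  rw [Finset.sum_const, Finset.card_univ, Fintype.card_fin, nsmul_eq_mul, mul_one]
  linarith

theorem not_achieves_of_const_mem {α : ℝ} (hα : α ∈ Set.Icc (0 : ℝ) 1)
    {Φ : Set (Fin 2 → Fin 2)} (hΦ : (fun _ => 1) ∈ Φ)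
    (alg : (T : ℕ) → Policy 1 (Fin 2) (Fin 2) T) : ¬ Achieves (Fin 3) Φ alg α (1 / 8) := by
  rintro ⟨r, v, hr, hv, hach⟩
  have hr' := hr.bound (c := 1 / 8) (by norm_num)
  have hv' := hv.bound (c := 1 / 16) (by norm_num)
  obtain ⟨T, hrT, hvT, hT, hT1⟩ := (hr'.and (hv'.and (hach.and (eventually_ge_atTop 1)))).exists
  have hT1' : (1 : ℝ) ≤ T := by exact_mod_cast hT1
  have hT0 : (0 : ℝ) < T := by linarith
  have hpa : 0 < (T : ℝ) ^ α := Real.rpow_pos_of_pos hT0 _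
  have hpb : 0 < (T : ℝ) ^ (1 - α / 2) := Real.rpow_pos_of_pos hT0 _
  have hpe : 0 < (T : ℝ) ^ (-(α / 2)) := Real.rpow_pos_of_pos hT0 _
  rw [Real.norm_of_nonneg hpa.le, Real.norm_eq_abs] at hrT
  rw [Real.norm_of_nonneg hpb.le, Real.norm_eq_abs] at hvT
  have hrT' := (le_abs_self _).trans hrT
  have hvT' := (le_abs_self _).trans hvT
  have hpaT : (T : ℝ) ^ α ≤ T := by
    simpa using Real.rpow_le_rpow_of_exponent_le hT1' hα.2
  -- The scale at which `e ^ 2 * T ^ α` stays constant while `e * T` has the order of the forbidden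
  -- violation.
  set e : ℝ := (T : ℝ) ^ (-(α / 2)) / 2 with he_def
  have he : e ∈ Set.Icc (0 : ℝ) (1 / 2) := by
    refine ⟨by positivity, ?_⟩
    have : (T : ℝ) ^ (-(α / 2)) ≤ 1 :=
      Real.rpow_le_one_of_one_le_of_nonpos hT1' (by linarith [hα.1])
    rw [he_def]; linarith
  have h : (0 : ℝ) ∈ Set.Icc (0 : ℝ) (1 / 2) := by norm_num
  have hesq : e ^ 2 * (T : ℝ) ^ α = 1 / 4 := by
    have : ((T : ℝ) ^ (-(α / 2))) ^ 2 * (T : ℝ) ^ α = 1 := by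
      rw [← Real.rpow_natCast, ← Real.rpow_mul hT0.le, ← Real.rpow_add hT0]
      convert Real.rpow_zero (T : ℝ) using 2
      push_cast; ring
    rw [he_def]; linear_combination this / 4
  have heT : e * T = (T : ℝ) ^ (1 - α / 2) / 2 := by
    have : (T : ℝ) ^ (1 - α / 2) = (T : ℝ) ^ (-(α / 2)) * T := by
      rw [← Real.rpow_add_one hT0.ne']
      ring_nf
    rw [he_def, this]; ring
  set E := fewMismatches (alg T) he (2 * r T) with hE_def
  have hexp : Real.exp (e ^ 2 * (2 * r T)) ≤ 3 / 2 := by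
    have h1 : e ^ 2 * (2 * r T) ≤ 1 / 16 := by
      nlinarith [mul_le_mul_of_nonneg_left hrT' (sq_nonneg e)]
    refine (Real.exp_le_exp.2 h1).trans ?_
    have h2 := Real.add_one_le_exp (-(1 / 16) : ℝ)
    have h3 : Real.exp (1 / 16) * Real.exp (-(1 / 16)) = 1 := by
      rw [← Real.exp_add]; simp
    nlinarith [Real.exp_pos (1 / 16)]
  have h0 : 1 - 1 / 8 < ((alg T).law (biasGame 0 h)).real E :=
    (hT (biasGame 0 h)).trans_le (measureReal_mono fun q hq =>
      sum_mismatch_le_of_regret_le (alg T) h Φ hq.1)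
  have h1 := two_mul_law_real_le (alg T) h he (2 * r T)
  rw [← hE_def] at h1
  -- From `2 * (7 / 8) < 1 + 3 / 2 * P` even `P > 1 / 2` follows; `1 / 8` suffices to contradict
  -- success with probability above `7 / 8`.
  have h2 : 1 / 8 < ((alg T).law (biasGame e he)).real E := by
    have := mul_le_mul_of_nonneg_right hexp
      (measureReal_nonneg (μ := (alg T).law (biasGame e he)) (s := E))
    linarith
  have hsub : {q | (alg T).regret (biasGame e he) Φ q ≤ r T ∧
      (alg T).cumViolation (biasGame e he) Φ q ≤ v T} ⊆ Eᶜ := by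
    intro q hq hqE
    have h3 := (le_cumViolation (alg T) he hΦ hqE).trans hq.2
    -- As `2 * r T ≤ T / 4`, the violation on `E` is at least `3 / 32 * T ^ (1 - α / 2)`, above the
    -- bound `1 / 16 * T ^ (1 - α / 2)` on `v T`.
    have h4 : e / 4 * (T - T / 4) ≤ e / 4 * (T - 2 * r T) :=
      mul_le_mul_of_nonneg_left (by linarith) (by linarith [he.1])
    linarith
  have h5 := (hT (biasGame e he)).trans_le (measureReal_mono hsub)
  rw [probReal_compl_eq_one_sub (measurableSet_fewMismatches _ _ _)] at h5
  linarith

end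

end InfoAcq

theorem mainTheorem4 (α : ℝ) (hα : α ∈ Set.Icc (1 / 2 : ℝ) 1) :
    ∃ δ ∈ Set.Ioo (0 : ℝ) 1, ∃ n nΘ nS nA : ℕ, 0 < n ∧ 0 < nΘ ∧ 0 < nS ∧ 0 < nA ∧
      ∀ Φ : Set (Fin nS → Fin nS),
        (InfoAcq.exAnte (Fin nS) ⊆ Φ ∨ InfoAcq.singleSignal (Fin nS) ⊆ Φ) →
        ∀ alg : (T : ℕ) → InfoAcq.Policy n (Fin nS) (Fin nA) T,
          ¬ InfoAcq.Achieves (Fin nΘ) Φ alg α δ := by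
  refine ⟨1 / 8, by norm_num, 1, 3, 2, 2, by norm_num, by norm_num, by norm_num, by norm_num,
    fun Φ hΦ alg => InfoAcq.not_achieves_of_const_mem ⟨by linarith [hα.1], hα.2⟩ ?_ alg⟩
  rcases hΦ with hΦ | hΦ
  · exact hΦ fun _ _ => rfl
  -- With two signals, the constant report `1` misreports only signal `0`, so it lies in both
  -- classes of deviations.
  · exact hΦ ⟨0, fun s hs => (Fin.eq_one_of_ne_zero s hs).symm⟩
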